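/- Let $X$ be a real reflexive Banach space with dual $X^*$, and write $\langle u,u^*\rangle$ for the duality pairing. A selfdual Lagrangian on $X\times X^*$ is a convex lower semicontinuous function $L:X\times X^*\to\mathbb R\cup\{+\infty\}$ such that, for all $(u,u^*)\in X\times X^*$, $$\sup\{\langle v,u^*\rangle+\langle u,v^*\rangle-L(v,v^*):(v,v^*)\in X\times X^*\}=L(u,u^*).$$ Its selfdual vector field is $\bar\partial L(u)=\{u^*\in X^*: L(u,u^*)=\langle u,u^*\rangle\}$, with graph $\{(u,u^*)\in X\times X^*: u^*\in\bar\partial L(u)\}$. Let $(F_n)_{n\in\mathbb N}$ be a sequence of selfdual Lagrangians on $X\times X^*$ and let $F$ be a selfdual Lagrangian on $X\times X^*$. Suppose that $F_n$ $\Gamma$-converges to $F$ for the norm topology of $X\times X^*$, that is: (1) whenever $(u_n,u_n^*)\to(u,u^*)$ strongly in $X\times X^*$, one has $F(u,u^*)\le\liminf_{n\to\infty}F_n(u_n,u_n^*)$; (2) for every $(u,u^*)\in X\times X^*$ there is a sequence $(u_n,u_n^*)\to(u,u^*)$ strongly in $X\times X^*$ with $\lim_{n\to\infty}F_n(u_n,u_n^*)=F(u,u^*)$.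 Then the graphs $A_n$ of $\bar\partial F_n$ converge to the graph $A$ of $\bar\partial F$ in the sense of Kuratowski–Painlevé in the norm topology of $X\times X^*$, that is, $$\mathrm{Ls}(A_n)=A=\mathrm{Li}(A_n),$$ where $\mathrm{Li}(A_n)$ is the set of all strong limits of sequences $(p_n)$ with $p_n\in A_n$ for every $n$, and $\mathrm{Ls}(A_n)$ is the set of all strong limits of sequences $(p_j)$ such that $p_j\in A_{k(j)}$ for every $j$, for some indices $k(j)\to\infty$. -/

import Mathlib

open Filter Topology

/-- A real normed space is reflexive when the canonical embedding into its bidual is onto. -/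
def IsReflexiveSpace (X : Type*) [NormedAddCommGroup X] [NormedSpace ℝ X] : Prop :=
  Function.Surjective (NormedSpace.inclusionInDoubleDual ℝ X)

/-- Convexity of an extended-real-valued function. Only strictly positive weights are used,
so that the convention `0 * ⊤ = 0` plays no role. -/
def IsConvexFun {E : Type*} [AddCommGroup E] [Module ℝ E] (F : E → EReal) : Prop :=
  ∀ x y : E, ∀ a b : ℝ, 0 < a → 0 < b → a + b = 1 →
    F (a • x + b • y) ≤ (a : EReal) * F x + (b : EReal) * F y

/-- The Fenchel-Legendre dual in both variables of a function on phase space,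
`L*(u*, u) = sup { ⟨v, u*⟩ + ⟨u, v*⟩ - L(v, v*) : (v, v*) ∈ X × X* }`. -/
noncomputable def phaseDual {X : Type*} [NormedAddCommGroup X] [NormedSpace ℝ X]
    (L : X × StrongDual ℝ X → EReal) (q : StrongDual ℝ X × X) : EReal :=
  ⨆ p : X × StrongDual ℝ X, ((q.1 p.1 + p.2 q.2 : ℝ) : EReal) - L p

/-- A selfdual Lagrangian on `X × X*`: a convex lower semicontinuous function with values in
`ℝ ∪ {+∞}` such that `L*(u*, u) = L(u, u*)` for all `(u, u*)`. -/
structure IsSelfdualLagrangian {X : Type*} [NormedAddCommGroup X] [NormedSpace ℝ X]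
    (L : X × StrongDual ℝ X → EReal) : Prop where
  ne_bot : ∀ p, L p ≠ ⊥
  convex : IsConvexFun L
  lsc : LowerSemicontinuous L
  selfdual : ∀ (u : X) (f : StrongDual ℝ X), phaseDual L (f, u) = L (u, f)

/-- The selfdual vector field of `L`: `u ↦ {u* : L(u, u*) = ⟨u, u*⟩}`. -/
def selfdualField {X : Type*} [NormedAddCommGroup X] [NormedSpace ℝ X]
    (L : X × StrongDual ℝ X → EReal) (u : X) : Set (StrongDual ℝ X) :=
  {f | L (u, f) = ((f u : ℝ) : EReal)}

/-- The graph of a set-valued map. -/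
def graphOf {X Y : Type*} (B : X → Set Y) : Set (X × Y) :=
  {p | p.2 ∈ B p.1}

/-- (Sequential, strong) `Γ`-convergence of a sequence of functionals. -/
def GammaConverges {E : Type*} [TopologicalSpace E] (Fs : ℕ → E → EReal) (F : E → EReal) : Prop :=
  (∀ (x : E) (u : ℕ → E), Tendsto u atTop (𝓝 x) →
    F x ≤ liminf (fun n => Fs n (u n)) atTop) ∧
  (∀ x : E, ∃ u : ℕ → E, Tendsto u atTop (𝓝 x) ∧
    Tendsto (fun n => Fs n (u n)) atTop (𝓝 (F x)))

/-- Sequential lower limit of a sequence of sets: limits of sequences `u n ∈ A n`. -/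
def lowerLimitSet {E : Type*} [TopologicalSpace E] (A : ℕ → Set E) : Set E :=
  {x | ∃ u : ℕ → E, (∀ n, u n ∈ A n) ∧ Tendsto u atTop (𝓝 x)}

/-- Sequential upper limit of a sequence of sets: limits of sequences `u n ∈ A (k n)`
with `k n → ∞`. -/
def upperLimitSet {E : Type*} [TopologicalSpace E] (A : ℕ → Set E) : Set E :=
  {x | ∃ k : ℕ → ℕ, Tendsto k atTop atTop ∧
    ∃ u : ℕ → E, (∀ n, u n ∈ A (k n)) ∧ Tendsto u atTop (𝓝 x)}

/-- Kuratowski-Painlevé convergence of a sequence of sets. -/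
def KuratowskiPainleveConverges {E : Type*} [TopologicalSpace E]
    (As : ℕ → Set E) (A : Set E) : Prop :=
  upperLimitSet As = A ∧ lowerLimitSet As = A

/-- Sandwich theorem: a continuous affine function separates a proper convex function from a
continuous concave function lying below it. -/
theorem exists_affine_between {E : Type*} [NormedAddCommGroup E] [NormedSpace ℝ E]
    {L : E → EReal} (hL : IsConvexFun L) (hproper : ∃ p, ∃ t : ℝ, L p ≤ t)
    {h : E → ℝ} (hc : Continuous h) (hconv : ConvexOn ℝ Set.univ h)
    (hle : ∀ p, ((-h p : ℝ) : EReal) ≤ L p) :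
    ∃ (ψ : StrongDual ℝ E) (c : ℝ),
      (∀ p, ((ψ p + c : ℝ) : EReal) ≤ L p) ∧ ∀ p, 0 ≤ h p + ψ p + c := by
  have hD : Convex ℝ {q : E × ℝ | q.2 < -h q.1} := by
    simpa using hconv.neg.convex_strict_hypograph
  have hDo : IsOpen {q : E × ℝ | q.2 < -h q.1} :=
    isOpen_lt continuous_snd (hc.comp continuous_fst).neg
  have hC : Convex ℝ {q : E × ℝ | L q.1 ≤ (q.2 : EReal)} := by
    rw [convex_iff_forall_pos]
    rintro ⟨x, s⟩ hx ⟨y, t⟩ hy a b ha hb hab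
    simp only [Set.mem_ofPred_eq] at hx hy
    simp only [Set.mem_ofPred_eq, Prod.smul_mk, Prod.mk_add_mk, smul_eq_mul]
    refine (hL x y a b ha hb hab).trans ?_
    rw [EReal.coe_add, EReal.coe_mul, EReal.coe_mul]
    exact add_le_add (mul_le_mul_of_nonneg_left hx (by exact_mod_cast ha.le))
      (mul_le_mul_of_nonneg_left hy (by exact_mod_cast hb.le))
  have hdisj : Disjoint {q : E × ℝ | q.2 < -h q.1} {q : E × ℝ | L q.1 ≤ (q.2 : EReal)} := by
    rw [Set.disjoint_left]
    rintro ⟨x, s⟩ h1 h2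
    have h3 := (hle x).trans h2
    rw [EReal.coe_le_coe_iff] at h3
    exact absurd h1 (not_lt.mpr h3)
  obtain ⟨φ, s, h1, h2⟩ := geometric_hahn_banach_open hD hDo hC hdisj
  set τ : ℝ := φ (0, 1) with hτ
  set ψ : StrongDual ℝ E := φ.comp (ContinuousLinearMap.inl ℝ E ℝ) with hψ
  have hφ : ∀ p t, φ (p, t) = ψ p + t * τ := by
    intro p t
    have : ((p, t) : E × ℝ) = (p, 0) + t • ((0 : E), (1 : ℝ)) := by simp
    rw [this, map_add, map_smul]
    simp [hψ, hτ]
  have hτ0 : 0 < τ := by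
    obtain ⟨p, t, hpt⟩ := hproper
    have e1 := h1 (p, -h p - 1) (by simp)
    have e2 := h2 (p, t) hpt
    have e3 := (hle p).trans hpt
    rw [EReal.coe_le_coe_iff] at e3
    rw [hφ] at e1 e2
    by_contra hn
    nlinarith
  have key : ∀ p, (-τ⁻¹ • ψ) p + s / τ = (s - ψ p) / τ := by
    intro p
    simp only [smul_apply, smul_eq_mul]
    field_simp
    ring
  refine ⟨-τ⁻¹ • ψ, s / τ, fun p => ?_, fun p => ?_⟩
  · rw [key]
    refine EReal.le_of_forall_lt_iff_le.mp fun t ht => ?_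
    have e2 := h2 (p, t) ht.le
    rw [hφ] at e2
    rw [EReal.coe_le_coe_iff, div_le_iff₀ hτ0]
    linarith
  · rw [add_assoc, key]
    have : -h p ≤ (s - ψ p) / τ := by
      refine le_of_forall_lt fun t ht => ?_
      have e1 := h1 (p, t) ht
      rw [hφ] at e1
      rw [lt_div_iff₀ hτ0]
      linarith
    linarith

/-- The conjugate of `‖·‖² / 2` dominates `‖·‖² / 2`. -/
theorem half_sq_norm_le_of_forall {E : Type*} [NormedAddCommGroup E] [NormedSpace ℝ E]
    (f : StrongDual ℝ E) (A : ℝ) (h : ∀ v, 0 ≤ ‖v‖ ^ 2 / 2 + f v + A) : ‖f‖ ^ 2 / 2 ≤ A := by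
  have hA : 0 ≤ A := by simpa using h 0
  have hb : ‖f‖ ≤ √(2 * A) := by
    refine f.opNorm_le_bound (Real.sqrt_nonneg _) fun v => ?_
    have hd : discrim (‖v‖ ^ 2 / 2) (f v) A ≤ 0 := by
      refine discrim_le_zero fun t => ?_
      have := h (t • v)
      rw [norm_smul, map_smul, smul_eq_mul, mul_pow, Real.norm_eq_abs, sq_abs] at this
      linarith
    rw [Real.norm_eq_abs]
    refine abs_le_of_sq_le_sq ?_ (by positivity)
    rw [mul_pow, Real.sq_sqrt (by positivity)]
    rw [discrim] at hd
    linarith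
  have := pow_le_pow_left₀ (norm_nonneg f) hb 2
  rw [Real.sq_sqrt (by positivity)] at this
  linarith

theorem neg_half_sq_norm_le_apply {X : Type*} [NormedAddCommGroup X] [NormedSpace ℝ X]
    (f : StrongDual ℝ X) (x : X) : -(‖x‖ ^ 2 / 2 + ‖f‖ ^ 2 / 2) ≤ f x := by
  have h1 := f.le_opNorm x
  rw [Real.norm_eq_abs] at h1
  nlinarith [neg_abs_le (f x), sq_nonneg (‖f‖ - ‖x‖)]

namespace IsSelfdualLagrangian

variable {X : Type*} [NormedAddCommGroup X] [NormedSpace ℝ X] {L : X × StrongDual ℝ X → EReal}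

theorem sub_le (hL : IsSelfdualLagrangian L) (u v : X) (f g : StrongDual ℝ X) :
    ((f v + g u : ℝ) : EReal) - L (v, g) ≤ L (u, f) := by
  rw [← hL.selfdual u f]
  exact le_iSup (fun p : X × StrongDual ℝ X => ((f p.1 + p.2 u : ℝ) : EReal) - L p) (v, g)

theorem apply_le (hL : IsSelfdualLagrangian L) (u : X) (f : StrongDual ℝ X) :
    ((f u : ℝ) : EReal) ≤ L (u, f) := by
  have h := hL.sub_le u u f f
  have hb := hL.ne_bot (u, f)
  generalize L (u, f) = y at h hb ⊢
  induction y using EReal.rec with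
  | bot => exact absurd rfl hb
  | top => exact le_top
  | coe r =>
    rw [← EReal.coe_sub, EReal.coe_le_coe_iff] at h
    rw [EReal.coe_le_coe_iff]
    linarith

theorem exists_le_coe (hL : IsSelfdualLagrangian L) : ∃ p, ∃ t : ℝ, L p ≤ t := by
  by_contra! hcon
  have htop : ∀ p, L p = ⊤ := fun p => by
    by_contra hp
    exact absurd (EReal.le_coe_toReal hp) (not_le.mpr (hcon p _))
  have h := hL.selfdual 0 0
  rw [phaseDual, htop] at h
  simp [htop] at h

/-- A selfdual Lagrangian dominates the duality pairing by at least half the squared distance to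
some point of the graph of its selfdual vector field. -/
theorem exists_mem_graph_near (hL : IsSelfdualLagrangian L) (hX : IsReflexiveSpace X)
    (u : X) (g : StrongDual ℝ X) :
    ∃ (x : X) (f : StrongDual ℝ X), L (x, f) = ((f x : ℝ) : EReal) ∧
      ((g u + (‖x - u‖ ^ 2 / 2 + ‖f - g‖ ^ 2 / 2) : ℝ) : EReal) ≤ L (u, g) := by
  let h : X × StrongDual ℝ X → ℝ := fun p =>
    ‖p.1 - u‖ ^ 2 / 2 + ‖p.2 - g‖ ^ 2 / 2 - g p.1 - p.2 u + g u
  have hc : Continuous h := by fun_prop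
  have sq_conv : ∀ {E : Type _} [NormedAddCommGroup E] [NormedSpace ℝ E] (x y z : E) (a b : ℝ),
      0 ≤ a → 0 ≤ b → a + b = 1 →
      ‖a • x + b • y - z‖ ^ 2 ≤ a * ‖x - z‖ ^ 2 + b * ‖y - z‖ ^ 2 := by
    intro E _ _ x y z a b ha hb hab
    have e : a • x + b • y - z = a • (x - z) + b • (y - z) := by
      rw [smul_sub, smul_sub, sub_add_sub_comm, ← add_smul, hab, one_smul]
    have h1 : ‖a • x + b • y - z‖ ≤ a * ‖x - z‖ + b * ‖y - z‖ := by
      rw [e]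
      refine (norm_add_le _ _).trans_eq ?_
      rw [norm_smul, norm_smul, Real.norm_of_nonneg ha, Real.norm_of_nonneg hb]
    have h2 := pow_le_pow_left₀ (norm_nonneg _) h1 2
    have hb' : b = 1 - a := by linarith
    subst hb'
    nlinarith [mul_nonneg (mul_nonneg ha hb) (sq_nonneg (‖x - z‖ - ‖y - z‖))]
  have hconv : ConvexOn ℝ Set.univ h := by
    refine ⟨convex_univ, fun p _ q _ a b ha hb hab => ?_⟩
    have h1 := sq_conv p.1 q.1 u a b ha hb hab
    have h2 := sq_conv p.2 q.2 g a b ha hb hab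
    have h3 : g u = (a + b) * g u := by rw [hab, one_mul]
    simp only [h, Prod.fst_add, Prod.snd_add, Prod.smul_fst, Prod.smul_snd, map_add, map_smul,
      smul_eq_mul, add_apply, smul_apply]
    linarith
  have hle : ∀ p, ((-h p : ℝ) : EReal) ≤ L p := by
    rintro ⟨v, k⟩
    refine le_trans ?_ (hL.apply_le v k)
    rw [EReal.coe_le_coe_iff]
    have := neg_half_sq_norm_le_apply (k - g) (v - u)
    simp only [map_sub, sub_apply] at this
    simp only [h]
    linarith
  obtain ⟨ψ, c, h1, h2⟩ := exists_affine_between hL.convex hL.exists_le_coe hc hconv hle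
  set f : StrongDual ℝ X := ψ.comp (ContinuousLinearMap.inl ℝ X (StrongDual ℝ X)) with hf
  obtain ⟨x, hx⟩ := hX (ψ.comp (ContinuousLinearMap.inr ℝ X (StrongDual ℝ X)))
  have hψ : ∀ v k, ψ (v, k) = f v + k x := by
    intro v k
    have e : k x = ψ (0, k) := by
      have := congrArg (fun F => F k) hx
      simpa using this
    have e' : ((v, k) : X × StrongDual ℝ X) = (v, 0) + (0, k) := by simp
    rw [e, e', map_add]
    simp [hf]
  have hup : L (x, f) ≤ ((-c : ℝ) : EReal) := by
    rw [← hL.selfdual x f]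
    refine iSup_le ?_
    rintro ⟨v, k⟩
    have e := h1 (v, k)
    rw [hψ] at e
    refine EReal.sub_le_of_le_add ?_
    calc ((f v + k x : ℝ) : EReal) = ((-c : ℝ) : EReal) + ((f v + k x + c : ℝ) : EReal) := by
          rw [← EReal.coe_add]; congr 1; ring
      _ ≤ _ := by gcongr
  have hk : ∀ (w : X) (k : StrongDual ℝ X), 0 ≤ ‖w‖ ^ 2 / 2 + ‖k‖ ^ 2 / 2 + (f - g) w + k (x - u)
      + (c - g u + f u + g x) := by
    intro w k
    have e := h2 (u + w, g + k)
    rw [hψ] at e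
    simp only [h, add_sub_cancel_left, map_add, add_apply] at e
    simp only [map_sub, sub_apply]
    linarith
  have hfb : ∀ k : StrongDual ℝ X,
      ‖f - g‖ ^ 2 / 2 ≤ ‖k‖ ^ 2 / 2 + k (x - u) + (c - g u + f u + g x) := fun k =>
    half_sq_norm_le_of_forall _ _ fun w => by linarith [hk w k]
  have hxb : ‖x - u‖ ^ 2 / 2 ≤ c - g u + f u + g x - ‖f - g‖ ^ 2 / 2 := by
    have := half_sq_norm_le_of_forall (NormedSpace.inclusionInDoubleDual ℝ X (x - u))
      (c - g u + f u + g x - ‖f - g‖ ^ 2 / 2) fun k => by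
        rw [NormedSpace.dual_def]
        linarith [hfb k]
    rwa [show ‖NormedSpace.inclusionInDoubleDual ℝ X (x - u)‖ = ‖x - u‖ from
      (NormedSpace.inclusionInDoubleDualLi ℝ).norm_map (x - u)] at this
  have hlow := hL.apply_le x f
  have hcx : f x ≤ -c := by exact_mod_cast hlow.trans hup
  have hpair := neg_half_sq_norm_le_apply (f - g) (x - u)
  simp only [map_sub, sub_apply] at hpair
  have hceq : f x = -c := by linarith
  have heq : L (x, f) = ((f x : ℝ) : EReal) := le_antisymm (hceq ▸ hup) hlow
  refine ⟨x, f, heq, le_trans ?_ (hL.sub_le u x g f)⟩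
  rw [heq, ← EReal.coe_sub, EReal.coe_le_coe_iff]
  linarith

end IsSelfdualLagrangian

theorem lowerLimitSet_subset_upperLimitSet {E : Type*} [TopologicalSpace E] (A : ℕ → Set E) :
    lowerLimitSet A ⊆ upperLimitSet A := fun _ ⟨u, hu, hlim⟩ => ⟨id, tendsto_id, u, hu, hlim⟩

/-- The liminf inequality of `Γ`-convergence passes to points indexed by any `k j → ∞`. -/
theorem GammaConverges.exists_strictMono_le_liminf {E : Type*} [TopologicalSpace E]
    {Fs : ℕ → E → EReal} {F : E → EReal} (hlim : GammaConverges Fs F) {k : ℕ → ℕ}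
    (hk : Tendsto k atTop atTop) {x : E} {u : ℕ → E} (hu : Tendsto u atTop (𝓝 x)) :
    ∃ φ : ℕ → ℕ, StrictMono φ ∧ F x ≤ liminf (fun j => Fs (k (φ j)) (u (φ j))) atTop := by
  obtain ⟨φ, hφ, hkφ⟩ := strictMono_subseq_of_tendsto_atTop hk
  refine ⟨φ, hφ, ?_⟩
  let w : ℕ → E := Function.extend (k ∘ φ) (u ∘ φ) fun _ => x
  have hwφ : ∀ j, w (k (φ j)) = u (φ j) := fun j => hkφ.injective.extend_apply _ _ j
  have hw : Tendsto w atTop (𝓝 x) := by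
    rw [tendsto_def]
    intro U hU
    obtain ⟨J, hJ⟩ := eventually_atTop.mp ((hu.comp hφ.tendsto_atTop).eventually hU)
    filter_upwards [eventually_ge_atTop (k (φ J))] with n hn
    by_cases hex : ∃ j, (k ∘ φ) j = n
    · obtain ⟨j, rfl⟩ := hex
      have hj := hJ j (hkφ.le_iff_le.mp hn)
      rw [Set.mem_preimage]
      exact (hwφ j).symm ▸ hj
    · rw [Set.mem_preimage, show w n = x from Function.extend_apply' _ _ _ hex]
      exact mem_of_mem_nhds hU
  refine (hlim.1 x w hw).trans ?_
  have h : liminf (fun n => Fs n (w n)) atTop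
      ≤ liminf (fun n => Fs n (w n)) (map (k ∘ φ) atTop) :=
    liminf_le_liminf_of_le hkφ.tendsto_atTop
  refine h.trans_eq ?_
  change liminf ((fun n => Fs n (w n)) ∘ (k ∘ φ)) atTop = _
  simp only [Function.comp_def, hwφ]

theorem tendsto_dual_apply {X : Type*} [NormedAddCommGroup X] [NormedSpace ℝ X]
    {u : ℕ → X × StrongDual ℝ X} {p : X × StrongDual ℝ X} (hu : Tendsto u atTop (𝓝 p)) :
    Tendsto (fun n => (u n).2 (u n).1) atTop (𝓝 (p.2 p.1)) :=
  ((continuous_snd.clm_apply continuous_fst).tendsto p).comp hu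

theorem upperLimitSet_graphOf_subset {X : Type*} [NormedAddCommGroup X] [NormedSpace ℝ X]
    {Fs : ℕ → X × StrongDual ℝ X → EReal} {F : X × StrongDual ℝ X → EReal}
    (hF : IsSelfdualLagrangian F) (hlim : GammaConverges Fs F) :
    upperLimitSet (fun n => graphOf (selfdualField (Fs n))) ⊆ graphOf (selfdualField F) := by
  rintro ⟨x, f⟩ ⟨k, hk, u, hu, hux⟩
  obtain ⟨φ, hφ, hle⟩ := hlim.exists_strictMono_le_liminf hk hux
  refine le_antisymm (hle.trans_eq ?_) (hF.apply_le x f)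
  have h : Tendsto (fun j => Fs (k (φ j)) (u (φ j))) atTop (𝓝 ((f x : ℝ) : EReal)) := by
    have e : (fun j => Fs (k (φ j)) (u (φ j)))
        = fun j => (((u (φ j)).2 (u (φ j)).1 : ℝ) : EReal) := funext fun j => hu (φ j)
    rw [e]
    exact (continuous_coe_real_ereal.tendsto _).comp
      ((tendsto_dual_apply hux).comp hφ.tendsto_atTop)
  exact h.liminf_eq

theorem graphOf_subset_lowerLimitSet {X : Type*} [NormedAddCommGroup X] [NormedSpace ℝ X]
    (hX : IsReflexiveSpace X)
    {Fs : ℕ → X × StrongDual ℝ X → EReal} {F : X × StrongDual ℝ X → EReal}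
    (hFs : ∀ n, IsSelfdualLagrangian (Fs n)) (hlim : GammaConverges Fs F) :
    graphOf (selfdualField F) ⊆ lowerLimitSet (fun n => graphOf (selfdualField (Fs n))) := by
  rintro ⟨x, f⟩ hxf
  have hxf' : F (x, f) = ((f x : ℝ) : EReal) := hxf
  obtain ⟨u, hu, hFu⟩ := hlim.2 (x, f)
  rw [hxf'] at hFu
  choose v g hvg hb using fun n => (hFs n).exists_mem_graph_near hX (u n).1 (u n).2
  refine ⟨fun n => (v n, g n), hvg, ?_⟩
  have hr : Tendsto (fun n => (Fs n (u n)).toReal - (u n).2 (u n).1) atTop (𝓝 0) := by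
    have h := (EReal.tendsto_toReal (EReal.coe_ne_top (f x)) (EReal.coe_ne_bot _)).comp hFu
    simpa using h.sub (tendsto_dual_apply hu)
  have hd : Tendsto (fun n => ‖v n - (u n).1‖ ^ 2 / 2 + ‖g n - (u n).2‖ ^ 2 / 2) atTop (𝓝 0) := by
    refine squeeze_zero' (Eventually.of_forall fun n => by positivity) ?_ hr
    filter_upwards [hFu.eventually_ne (EReal.coe_ne_top (f x))] with n hn
    have h := (hb n).trans (EReal.le_coe_toReal hn)
    rw [EReal.coe_le_coe_iff] at h
    linarith
  have of_sq : ∀ {a : ℕ → ℝ}, (∀ n, 0 ≤ a n) → (∀ n, a n ^ 2 / 2 ≤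
      ‖v n - (u n).1‖ ^ 2 / 2 + ‖g n - (u n).2‖ ^ 2 / 2) → Tendsto a atTop (𝓝 0) := by
    intro a ha hab
    have hs := (hd.const_mul 2).sqrt
    rw [mul_zero, Real.sqrt_zero] at hs
    exact squeeze_zero ha (fun n => Real.le_sqrt_of_sq_le (by linarith [hab n])) hs
  have h1 : Tendsto (fun n => v n - (u n).1) atTop (𝓝 0) :=
    tendsto_zero_iff_norm_tendsto_zero.mpr
      (of_sq (fun n => norm_nonneg _) fun n => le_add_of_nonneg_right (by positivity))
  have h2 : Tendsto (fun n => g n - (u n).2) atTop (𝓝 0) :=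
    tendsto_zero_iff_norm_tendsto_zero.mpr
      (of_sq (fun n => norm_nonneg _) fun n => le_add_of_nonneg_left (by positivity))
  have h := (h1.prodMk_nhds h2).add hu
  rw [Prod.mk_zero_zero, zero_add] at h
  exact h.congr fun n => Prod.ext (sub_add_cancel _ _) (sub_add_cancel _ _)

theorem theorem2p4 {X : Type*} [NormedAddCommGroup X] [NormedSpace ℝ X] [CompleteSpace X]
    (hX : IsReflexiveSpace X)
    (Fs : ℕ → X × StrongDual ℝ X → EReal) (F : X × StrongDual ℝ X → EReal)
    (hFs : ∀ n, IsSelfdualLagrangian (Fs n)) (hF : IsSelfdualLagrangian F)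
    (hlim : GammaConverges Fs F) :
    KuratowskiPainleveConverges
      (fun n => graphOf (selfdualField (Fs n))) (graphOf (selfdualField F)) := by
  have hupper := upperLimitSet_graphOf_subset hF hlim
  have hlower := graphOf_subset_lowerLimitSet hX hFs hlim
  have hsub := lowerLimitSet_subset_upperLimitSet fun n => graphOf (selfdualField (Fs n))
  exact ⟨hupper.antisymm (hlower.trans hsub), (hsub.trans hupper).antisymm hlower⟩
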